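/- Let $K\ge 2$, let $X$ take values in $[K]=\{1,\dots,K\}$, $W$ in $\{0,1\}$ and $Y$ in $\mathbb{R}$, and let $(X_i,W_i,Y_i)_{i\ge 1}$ be iid copies of $(X,W,Y)$. For $h\in\mathbb{R}^K$, also viewed as a function $[K]\to\mathbb{R}$, put $P_0(h)=\mathbb{E}[Y-h(X)\mid W=0]$ and, for $m\ge 1$, $$P_m(h)=\mathbb{E}[(Y-h(X))^m\mid W=0]-\mathbb{E}[(Y-h(X))^m\mid W=1],$$ $\Gamma=(P_0,\dots,P_{K+1})$ and $\Lambda=(P_0,\dots,P_{K-1})$. With $Q_{j,\ell,k}=\mathbb{E}[Y^j\mathbf 1_{W=\ell,X=k}]/\mathbb{P}(W=\ell)$ one has $P_0(h)=\sum_k\sum_{j=0}^{1}Q_{j,0,k}(-h_k)^{1-j}$ and $P_m(h)=\sum_k\sum_{j=0}^m\binom mj(Q_{j,0,k}-Q_{j,1,k})(-h_k)^{m-j}$ for $m\ge1$; let $\widehat\Gamma,\widehat\Lambda$ be given by the same formulas with $\widehat Q_{j,\ell,k}=\big(\tfrac1n\sum_{i\le n}Y_i^j\mathbf 1_{W_i=\ell,X_i=k}\big)\big/\big(\tfrac1n\sum_{i\le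 n}\mathbf 1_{W_i=\ell}\big)$ in place of $Q_{j,\ell,k}$. Assume: (i) $\mathbb{E}[|Y|^{K+1}\mid W=\ell,X=k]<\infty$ for all $\ell\in\{0,1\}$ and all $k\in[K]$ (with $\mathbb{P}(W=\ell,X=k)>0$), and $\mathbb{P}(W=0),\mathbb{P}(W=1)>0$; (ii) $g\in\mathbb{R}^K$ is the unique zero of $\Gamma$ in $\mathbb{R}^K$, and $\|g\|<R$ (Euclidean norm) for a known constant $R$; (iii) the Jacobian matrix $V=D_h\Lambda(h)|_{h=g}\in\mathbb{R}^{K\times K}$ is invertible. Let $\tilde g=\tilde g_n$ be any (measurable) choice of $$\tilde g\in\operatorname*{argmin}_{h\in\mathcal Z_R(\widehat\Lambda)}\|\widehat\Gamma(h)\|,$$ where $\mathcal Z_R(\gamma)$ is the set of zeros of $\gamma$ in the closed ball $\{\|h\|\le R\}$ if there are any, and the whole closed ball otherwise ($\tilde g$ is arbitrary on samples in which one of the values of $W$ does not occur). Let $T$ be the random vector in $\mathbb{R}^{2K^2+2}$ with the coordinates $Y^j\mathbf 1_{W=\ell,X=k}$ ($0\le j\le K-1$, $\ell\in\{0,1\}$,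 $k\in[K]$) and $\mathbf 1_{W=0},\mathbf 1_{W=1}$; let $w^*=\mathbb{E}[T]$, let $\widehat{w}$ be the sample mean of $T$, and let $\Omega$ be the covariance matrix of $T$. For $w\in\mathbb{R}^{2K^2+2}$ with coordinates $w_{j,\ell,k}$ and $w_\ell$, let $\Psi(v,w)\in\mathbb{R}^K$ be the value at $v\in\mathbb{R}^K$ of $(P_0,\dots,P_{K-1})$ with $Q_{j,\ell,k}$ replaced by $w_{j,\ell,k}/w_\ell$, so that $\Psi(\cdot,w^*)=\Lambda$ and $\Psi(\cdot,\widehat w)=\widehat\Lambda$. Let $\Delta=D_w\Psi(g,w)|_{w=w^*}$. Then: (a) There are open neighbourhoods $A$ of $g$ and $B$ of $w^*$ and a continuously differentiable $\omega:B\to A$ with $\omega(w^*)=g$ such that, for $w\in B$ and $v\in A$, $\Psi(v,w)=0$ if and only if $v=\omega(w)$; and $D_w\omega(w^*)=-V^{-1}\Delta$. (b) If the coordinates of $T$ are square integrable (so that $\Omega$ exists), then $$\sqrt n\,(\tilde g-g)\xrightarrow{d}N\big(0,\;D_w\omega(w^*)\,\Omega\,D_w\omega(w^*)'\big).$$ (c)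 If $\mathbb{E}[Y^{2K-2}\mathbf 1_{W=\ell,X=k}]<\infty$ for all $\ell\in\{0,1\}$, $k\in[K]$, then $D_w\omega(w^*)$ and $\Omega$ can be estimated consistently: almost surely, as $n\to\infty$, $$-\big(D_h\Psi(h,\widehat w)|_{h=\tilde g}\big)^{-1}D_w\Psi(\tilde g,w)|_{w=\widehat w}\longrightarrow D_w\omega(w^*),$$ and the sample covariance matrix $\widehat\Omega=\tfrac1n\sum_{i\le n}T_iT_i'-\big(\tfrac1n\sum_{i\le n}T_i\big)\big(\tfrac1n\sum_{i\le n}T_i\big)'$ converges to $\Omega$, where $T_i$ is the vector $T$ formed from $(X_i,W_i,Y_i)$. -/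

import Mathlib

open MeasureTheory ProbabilityTheory Filter Topology

namespace PolyIV

noncomputable section

/-- Functions `h : [K] → ℝ`, viewed as vectors with the Euclidean norm. -/
abbrev Vec (K : ℕ) : Type := EuclideanSpace ℝ (Fin K)

/-- An observation `(x, w, y)` of regressor, binary instrument and outcome. -/
abbrev Obs (K : ℕ) : Type := Fin K × Fin 2 × ℝ

/-- The `2 K ^ 2 + 2` coordinates of the coefficient vector: triples `(j, ℓ, k)` with
`0 ≤ j ≤ K - 1`, `ℓ ∈ {0, 1}`, `k ∈ [K]`, and two more for `ℓ ∈ {0, 1}`. -/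
abbrev Coord (K : ℕ) : Type := (Fin K × Fin 2 × Fin K) ⊕ Fin 2

/-- The space in which the coefficient vector `w` lives. -/
abbrev CoefVec (K : ℕ) : Type := EuclideanSpace ℝ (Coord K)

/-- The Jacobian matrix of `f` at `x`. -/
def jacobian {ι κ : Type*} [Fintype ι] [Fintype κ] [DecidableEq κ]
    (f : EuclideanSpace ℝ κ → EuclideanSpace ℝ ι) (x : EuclideanSpace ℝ κ) : Matrix ι κ ℝ :=
  Matrix.of fun i j => fderiv ℝ f x (EuclideanSpace.single j 1) i

/-- `y ^ j * 1_{w = ℓ, x = k}` at the observation `(x, w, y)`. -/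
def cellPow {K : ℕ} (j : ℕ) (l : Fin 2) (k : Fin K) (o : Obs K) : ℝ :=
  if o.2.1 = l ∧ o.1 = k then o.2.2 ^ j else 0

/-- `1_{w = ℓ}` at the observation `(x, w, y)`. -/
def instrInd {K : ℕ} (l : Fin 2) (o : Obs K) : ℝ :=
  if o.2.1 = l then 1 else 0

/-- The vector of all `y ^ j * 1_{w = ℓ, x = k}`, `j ≤ K - 1`, and of the `1_{w = ℓ}`. -/
def statVec {K : ℕ} (o : Obs K) : CoefVec K :=
  WithLp.toLp 2 (Sum.elim (fun i => cellPow (i.1 : ℕ) i.2.1 i.2.2 o) (fun l => instrInd l o))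

/-- The polynomial with index `m` and coefficients `Q j ℓ k`. -/
def polyP {K : ℕ} (Q : ℕ → Fin 2 → Fin K → ℝ) (m : ℕ) (h : Vec K) : ℝ :=
  if m = 0 then
    ∑ k : Fin K, ∑ j ∈ Finset.range 2, Q j 0 k * (-(h k)) ^ (1 - j)
  else
    ∑ k : Fin K, ∑ j ∈ Finset.range (m + 1),
      (m.choose j : ℝ) * (Q j 0 k - Q j 1 k) * (-(h k)) ^ (m - j)

/-- The map `Ψ(v, w)`, with coordinates `m = 0, …, K - 1`: the polynomials whose coefficients are
formed from the coefficient vector `w`. -/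
def Psi {K : ℕ} (v : Vec K) (w : CoefVec K) : Vec K :=
  WithLp.toLp 2 fun m : Fin K =>
    polyP (fun j l k => if hj : j < K then w (Sum.inl (⟨j, hj⟩, l, k)) / w (Sum.inr l) else 0)
      (m : ℕ) v

section Population

variable {K : ℕ} {Ω : Type*} [MeasurableSpace Ω]

/-- `P_0(h) = E[Y - h(X) | W = 0]` and
`P_m(h) = E[(Y - h(X)) ^ m | W = 0] - E[(Y - h(X)) ^ m | W = 1]` for `m ≥ 1`. -/
def popP (P : Measure Ω) (X : Ω → Fin K) (W : Ω → Fin 2) (Y : Ω → ℝ) (m : ℕ) (h : Vec K) : ℝ :=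
  if m = 0 then ∫ ω, (Y ω - h (X ω)) ∂(P[|W ⁻¹' {0}])
  else (∫ ω, (Y ω - h (X ω)) ^ m ∂(P[|W ⁻¹' {0}])) - ∫ ω, (Y ω - h (X ω)) ^ m ∂(P[|W ⁻¹' {1}])

/-- `Γ = (P_0, …, P_{K+1})`. -/
def popGamma (P : Measure Ω) (X : Ω → Fin K) (W : Ω → Fin 2) (Y : Ω → ℝ) (h : Vec K) :
    EuclideanSpace ℝ (Fin (K + 2)) :=
  WithLp.toLp 2 fun m : Fin (K + 2) => popP P X W Y (m : ℕ) h

/-- `Λ = (P_0, …, P_{K-1})`. -/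
def popLambda (P : Measure Ω) (X : Ω → Fin K) (W : Ω → Fin 2) (Y : Ω → ℝ) (h : Vec K) : Vec K :=
  WithLp.toLp 2 fun m : Fin K => popP P X W Y (m : ℕ) h

/-- `w* = E[T]` for the vector `T` of the statistics `Y ^ j 1_{W = ℓ, X = k}`, `1_{W = ℓ}`. -/
def wStar (P : Measure Ω) (X : Ω → Fin K) (W : Ω → Fin 2) (Y : Ω → ℝ) : CoefVec K :=
  WithLp.toLp 2 fun a : Coord K => ∫ ω, statVec (X ω, W ω, Y ω) a ∂P

/-- `V`, the matrix of the partial derivatives of `P_0, …, P_{K-1}` at `g`. -/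
def matV (P : Measure Ω) (X : Ω → Fin K) (W : Ω → Fin 2) (Y : Ω → ℝ) (g : Vec K) :
    Matrix (Fin K) (Fin K) ℝ :=
  jacobian (popLambda P X W Y) g

/-- `Δ`, the Jacobian of `Ψ` with respect to `w` at `(g, w*)`. -/
def matDelta (P : Measure Ω) (X : Ω → Fin K) (W : Ω → Fin 2) (Y : Ω → ℝ) (g : Vec K) :
    Matrix (Fin K) (Coord K) ℝ :=
  jacobian (fun w => Psi g w) (wStar P X W Y)

/-- `- V⁻¹ Δ`. -/
def matD (P : Measure Ω) (X : Ω → Fin K) (W : Ω → Fin 2) (Y : Ω → ℝ) (g : Vec K) :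
    Matrix (Fin K) (Coord K) ℝ :=
  -((matV P X W Y g)⁻¹ * matDelta P X W Y g)

/-- The covariance matrix of the vector of the statistics `Y ^ j 1_{W = ℓ, X = k}`, `1_{W = ℓ}`. -/
def matOmega (P : Measure Ω) (X : Ω → Fin K) (W : Ω → Fin 2) (Y : Ω → ℝ) :
    Matrix (Coord K) (Coord K) ℝ :=
  Matrix.of fun a b =>
    cov[fun ω => statVec (X ω, W ω, Y ω) a, fun ω => statVec (X ω, W ω, Y ω) b; P]

end Population

section Sample

variable {K n : ℕ}

/-- The average of `f` over the sample `s`. -/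
def sampleMean (s : Fin n → Obs K) (f : Obs K → ℝ) : ℝ :=
  (n : ℝ)⁻¹ * ∑ i : Fin n, f (s i)

/-- The plug-in coefficients: sample mean of `Y ^ j 1_{W = ℓ, X = k}` over that of `1_{W = ℓ}`. -/
def qHat (s : Fin n → Obs K) (j : ℕ) (l : Fin 2) (k : Fin K) : ℝ :=
  sampleMean s (cellPow j l k) / sampleMean s (instrInd l)

/-- The empirical `Γ`. -/
def gammaHat (s : Fin n → Obs K) (h : Vec K) : EuclideanSpace ℝ (Fin (K + 2)) :=
  WithLp.toLp 2 fun m : Fin (K + 2) => polyP (qHat s) (m : ℕ) h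

/-- The empirical `Λ`. -/
def lambdaHat (s : Fin n → Obs K) (h : Vec K) : Vec K :=
  WithLp.toLp 2 fun m : Fin K => polyP (qHat s) (m : ℕ) h

open Classical in
/-- The zeros of `γ` in the closed ball of radius `R` if there are any, else the whole ball. -/
def zeroSet (R : ℝ) (γ : Vec K → Vec K) : Set (Vec K) :=
  if ∃ h, ‖h‖ ≤ R ∧ γ h = 0 then {h | ‖h‖ ≤ R ∧ γ h = 0} else {h | ‖h‖ ≤ R}

/-- `h` is a minimizer of the norm of the empirical `Γ` over the first-stage solution set. -/
def IsTwoStage (R : ℝ) (s : Fin n → Obs K) (h : Vec K) : Prop :=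
  h ∈ zeroSet R (lambdaHat s) ∧ IsMinOn (fun v => ‖gammaHat s v‖) (zeroSet R (lambdaHat s)) h

/-- The empirical version of `w*`. -/
def wHat (s : Fin n → Obs K) : CoefVec K :=
  WithLp.toLp 2 fun a : Coord K => sampleMean s (fun o => statVec o a)

/-- The plug-in estimator of the Jacobian `- V⁻¹ Δ`, at an estimate `v` of `g`. -/
def dHat (s : Fin n → Obs K) (v : Vec K) : Matrix (Fin K) (Coord K) ℝ :=
  -((jacobian (fun h => Psi h (wHat s)) v)⁻¹ * jacobian (fun w => Psi v w) (wHat s))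

/-- The sample covariance matrix. -/
def omegaHat (s : Fin n → Obs K) : Matrix (Coord K) (Coord K) ℝ :=
  Matrix.of fun a b => sampleMean s (fun o => statVec o a * statVec o b)
    - sampleMean s (fun o => statVec o a) * sampleMean s (fun o => statVec o b)

end Sample

end

end PolyIV

/-!
The estimator is an implicit function of sample means. Conditioning on `W = ℓ` and expanding
`(Y - h(X)) ^ m` by the binomial theorem in each cell turns `P_m` into the polynomial `polyP` with
coefficients `popQ` (`popP_eq_polyP`), so that `popLambda = Psi · w*`; likewise
`lambdaHat = Psi · ŵ`. `Psi` is rational in `w` with nonvanishing denominators at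
`w*`, hence continuously differentiable near `(w*, g)`, and the implicit function theorem gives `ω`
together with its derivative `-V⁻¹ Δ` (`exists_implicitFunction_jacobian`).

By the strong law of large numbers, almost surely `ŵ → w*` and all `Q̂ → Q`. Thus `ω(ŵ)` is
eventually a zero of `lambdaHat` in the ball, and so is the estimator. As `ω(ŵ) → g`, the minimal
value of `‖gammaHat‖` tends to `‖popGamma g‖ = 0`, and by compactness of the ball and uniqueness of
the zero of `popGamma` the estimator converges to `g` (`tendsto_of_isTwoStage`). There `ω(ŵ)` is the
only zero of `Psi · ŵ`, so the estimator eventually equals `ω(ŵ)` (`ae_twoStage_eq_implicit`).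

Asymptotic normality is now the delta method applied to the multivariate central limit theorem for
`ŵ` (`tendstoInDistribution_sqrt_smul_mean_sub`, obtained from the real one through characteristic
functions), and the plug-in estimators converge because the Jacobians of `Psi` and matrix inversion
are continuous at the limit.
-/

open scoped Matrix RealInnerProductSpace

set_option linter.unusedSectionVars false

/-! ### Jacobian matrices and the implicit function theorem -/

namespace PolyIV

section Jacobian

variable {ι κ ν : Type*} [Fintype ι] [Fintype κ] [DecidableEq κ] [Fintype ν] [DecidableEq ν]

/-- The matrix of a continuous linear map between Euclidean spaces in the standard bases, so that
`jacobian f x = stdMatrix (fderiv ℝ f x)` by definition. -/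
noncomputable def stdMatrix (L : EuclideanSpace ℝ κ →L[ℝ] EuclideanSpace ℝ ι) : Matrix ι κ ℝ :=
  Matrix.of fun i j => L (EuclideanSpace.single j 1) i

lemma jacobian_eq_stdMatrix (f : EuclideanSpace ℝ κ → EuclideanSpace ℝ ι)
    (x : EuclideanSpace ℝ κ) : jacobian f x = stdMatrix (fderiv ℝ f x) := rfl

lemma apply_eq_stdMatrix_mulVec (L : EuclideanSpace ℝ κ →L[ℝ] EuclideanSpace ℝ ι)
    (x : EuclideanSpace ℝ κ) : L x = WithLp.toLp 2 (stdMatrix L *ᵥ x.ofLp) := by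
  have hx : x = ∑ j, x j • EuclideanSpace.single j (1 : ℝ) := by
    ext i
    simp [Pi.single_apply]
  ext i
  conv_lhs => rw [hx]
  simp [stdMatrix, Matrix.mulVec, dotProduct, mul_comm]

lemma stdMatrix_comp (L : EuclideanSpace ℝ κ →L[ℝ] EuclideanSpace ℝ ι)
    (M : EuclideanSpace ℝ ν →L[ℝ] EuclideanSpace ℝ κ) :
    stdMatrix (L ∘L M) = stdMatrix L * stdMatrix M := by
  ext i j
  simp only [stdMatrix, Matrix.of_apply, ContinuousLinearMap.comp_apply, Matrix.mul_apply]
  rw [apply_eq_stdMatrix_mulVec L]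
  simp [stdMatrix, Matrix.mulVec, dotProduct]

lemma stdMatrix_neg (L : EuclideanSpace ℝ κ →L[ℝ] EuclideanSpace ℝ ι) :
    stdMatrix (-L) = -stdMatrix L := by
  ext i j
  simp [stdMatrix]

lemma continuous_stdMatrix :
    Continuous (stdMatrix : (EuclideanSpace ℝ κ →L[ℝ] EuclideanSpace ℝ ι) → Matrix ι κ ℝ) := by
  refine continuous_pi fun i => continuous_pi fun j => ?_
  simp only [stdMatrix, Matrix.of_apply]
  fun_prop

lemma isInvertible_of_isUnit_stdMatrix {L : EuclideanSpace ℝ κ →L[ℝ] EuclideanSpace ℝ κ}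
    (hL : IsUnit (stdMatrix L)) : L.IsInvertible := by
  have hinj : Function.Injective L := by
    intro x y hxy
    rw [apply_eq_stdMatrix_mulVec, apply_eq_stdMatrix_mulVec] at hxy
    exact WithLp.ofLp_injective 2
      (Matrix.mulVec_injective_of_isUnit hL ((WithLp.toLp_injective 2) hxy))
  refine ⟨(LinearEquiv.ofInjectiveEndo L.toLinearMap hinj).toContinuousLinearEquiv, ?_⟩
  ext x
  rfl

/-- Matrix inversion is continuous at invertible matrices: `A⁻¹` is the adjugate over `det A`. -/
lemma continuousAt_matrix_inv {A : Matrix κ κ ℝ} (hA : IsUnit A) :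
    ContinuousAt (fun B : Matrix κ κ ℝ => B⁻¹) A := by
  have hdet : A.det ≠ 0 := ((Matrix.isUnit_iff_isUnit_det A).1 hA).ne_zero
  have hc : Continuous fun B : Matrix κ κ ℝ => B.det := continuous_id.matrix_det
  have ha : Continuous fun B : Matrix κ κ ℝ => B.adjugate := continuous_id.matrix_adjugate
  simp only [Matrix.inv_def, Ring.inverse_eq_inv']
  exact (hc.continuousAt.inv₀ hdet).smul ha.continuousAt

section ProdDomain

variable {F : EuclideanSpace ℝ ν × EuclideanSpace ℝ κ → EuclideanSpace ℝ ι}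
  {u : EuclideanSpace ℝ ν × EuclideanSpace ℝ κ}

lemma jacobian_snd_eq (hF : DifferentiableAt ℝ F u) :
    jacobian (fun v => F (u.1, v)) u.2
      = stdMatrix (fderiv ℝ F u ∘L .inr ℝ (EuclideanSpace ℝ ν) (EuclideanSpace ℝ κ)) := by
  have h : HasFDerivAt (fun v => F (u.1, v))
      (fderiv ℝ F u ∘L .inr ℝ (EuclideanSpace ℝ ν) (EuclideanSpace ℝ κ)) u.2 :=
    HasFDerivAt.comp (g := F) u.2 hF.hasFDerivAt (hasFDerivAt_prodMk_right u.1 u.2)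
  rw [jacobian_eq_stdMatrix, h.fderiv]

lemma jacobian_fst_eq (hF : DifferentiableAt ℝ F u) :
    jacobian (fun w => F (w, u.2)) u.1
      = stdMatrix (fderiv ℝ F u ∘L .inl ℝ (EuclideanSpace ℝ ν) (EuclideanSpace ℝ κ)) := by
  have h : HasFDerivAt (fun w => F (w, u.2))
      (fderiv ℝ F u ∘L .inl ℝ (EuclideanSpace ℝ ν) (EuclideanSpace ℝ κ)) u.1 :=
    HasFDerivAt.comp (g := F) u.1 hF.hasFDerivAt (hasFDerivAt_prodMk_left u.1 u.2)
  rw [jacobian_eq_stdMatrix, h.fderiv]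

lemma continuousAt_jacobian_snd (hF : ContDiffAt ℝ 1 F u) :
    ContinuousAt (fun p : EuclideanSpace ℝ ν × EuclideanSpace ℝ κ =>
      jacobian (fun v => F (p.1, v)) p.2) u := by
  have hc : ContinuousAt (fderiv ℝ F) u := (hF.fderiv_right (m := 0) (by norm_num)).continuousAt
  have h : ContinuousAt (fun p => stdMatrix (fderiv ℝ F p ∘L
      .inr ℝ (EuclideanSpace ℝ ν) (EuclideanSpace ℝ κ))) u :=
    continuous_stdMatrix.continuousAt.comp (hc.clm_comp continuousAt_const)
  refine h.congr ?_
  filter_upwards [hF.eventually (by simp)] with p hp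
  exact (jacobian_snd_eq (hp.differentiableAt (by simp))).symm

lemma continuousAt_jacobian_fst (hF : ContDiffAt ℝ 1 F u) :
    ContinuousAt (fun p : EuclideanSpace ℝ ν × EuclideanSpace ℝ κ =>
      jacobian (fun w => F (w, p.2)) p.1) u := by
  have hc : ContinuousAt (fderiv ℝ F) u := (hF.fderiv_right (m := 0) (by norm_num)).continuousAt
  have h : ContinuousAt (fun p => stdMatrix (fderiv ℝ F p ∘L
      .inl ℝ (EuclideanSpace ℝ ν) (EuclideanSpace ℝ κ))) u :=
    continuous_stdMatrix.continuousAt.comp (hc.clm_comp continuousAt_const)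
  refine h.congr ?_
  filter_upwards [hF.eventually (by simp)] with p hp
  exact (jacobian_fst_eq (hp.differentiableAt (by simp))).symm

end ProdDomain

/-- The implicit function theorem in matrix form, with the zero set of `F` described on a whole
product neighbourhood `B × A` by the implicit function. -/
theorem exists_implicitFunction_jacobian
    {F : EuclideanSpace ℝ ν × EuclideanSpace ℝ κ → EuclideanSpace ℝ κ}
    {w : EuclideanSpace ℝ ν} {v : EuclideanSpace ℝ κ}
    (hF : ContDiffAt ℝ 1 F (w, v)) (h0 : F (w, v) = 0)
    (hV : IsUnit (jacobian (fun v' => F (w, v')) v)) :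
    ∃ (A : Set (EuclideanSpace ℝ κ)) (B : Set (EuclideanSpace ℝ ν))
      (om : EuclideanSpace ℝ ν → EuclideanSpace ℝ κ),
      IsOpen A ∧ IsOpen B ∧ v ∈ A ∧ w ∈ B ∧ Set.MapsTo om B A ∧ ContDiffOn ℝ 1 om B ∧ om w = v ∧
      (∀ w' ∈ B, ∀ v' ∈ A, F (w', v') = 0 ↔ v' = om w') ∧
      jacobian om w
        = -((jacobian (fun v' => F (w, v')) v)⁻¹ * jacobian (fun w' => F (w', v)) w) := by
  have hd : DifferentiableAt ℝ F (w, v) := hF.differentiableAt (by simp)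
  have hsnd := jacobian_snd_eq hd
  have hfst := jacobian_fst_eq hd
  simp only at hsnd hfst
  have hinv : (fderiv ℝ F (w, v) ∘L
      .inr ℝ (EuclideanSpace ℝ ν) (EuclideanSpace ℝ κ)).IsInvertible :=
    isInvertible_of_isUnit_stdMatrix (hsnd ▸ hV)
  set om := hF.implicitFunction one_ne_zero hinv with hom
  have hself : om w = v := hF.implicitFunction_apply_self one_ne_zero hinv
  have hcd : ContDiffAt ℝ 1 om w := hF.contDiffAt_implicitFunction one_ne_zero hinv
  have hder : HasStrictFDerivAt om _ w := hF.hasStrictFDerivAt_implicitFunction one_ne_zero hinv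
  have hiff := hF.eventually_apply_eq_iff_implicitFunction one_ne_zero hinv
  rw [h0, ← hom] at hiff
  obtain ⟨U, A, hU, hwU, hA, hvA, hUA⟩ := mem_nhds_prod_iff'.1 hiff
  have hev : ∀ᶠ w' in 𝓝 w, w' ∈ U ∧ om w' ∈ A ∧ ContDiffAt ℝ 1 om w' :=
    (hU.eventually_mem hwU).and ((hcd.continuousAt.eventually
      (by rw [hself]; exact hA.mem_nhds hvA)).and (hcd.eventually (by simp)))
  obtain ⟨B, hB, hBo, hwB⟩ := eventually_nhds_iff.1 hev
  refine ⟨A, B, om, hA, hBo, hvA, hwB, fun w' hw' => (hB w' hw').2.1,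
    fun w' hw' => (hB w' hw').2.2.contDiffWithinAt, hself, fun w' hw' v' hv' => ?_, ?_⟩
  · exact (hUA (Set.mk_mem_prod (hB w' hw').1 hv')).trans eq_comm
  · rw [hsnd, hfst, jacobian_eq_stdMatrix, hder.hasFDerivAt.fderiv]
    set L := fderiv ℝ F (w, v) ∘L .inr ℝ (EuclideanSpace ℝ ν) (EuclideanSpace ℝ κ)
    have hone : stdMatrix L.inverse = (stdMatrix L)⁻¹ := by
      refine (Matrix.inv_eq_left_inv ?_).symm
      rw [← stdMatrix_comp, hinv.inverse_comp_self]
      ext i j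
      simp [stdMatrix, Matrix.one_apply]
    rw [stdMatrix_neg, stdMatrix_comp, hone]

end Jacobian

end PolyIV

/-! ### The multivariate central limit theorem -/

section CentralLimit

variable {ι κ : Type*} [Fintype ι] [DecidableEq ι] [Fintype κ] [DecidableEq κ]

lemma dotProduct_covMatrix_mulVec {Ω : Type*} [MeasurableSpace Ω] {P : Measure Ω}
    [IsProbabilityMeasure P] {Z : ι → Ω → ℝ} (hZ : ∀ a, MemLp (Z a) 2 P) (t : ι → ℝ) :
    t ⬝ᵥ (Matrix.of fun a b => cov[Z a, Z b; P]) *ᵥ t = Var[fun ω => ∑ a, t a * Z a ω; P] := by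
  have hm : ∀ a, MemLp (fun ω => t a * Z a ω) 2 P := fun a => (hZ a).const_mul (t a)
  rw [← covariance_self (memLp_finsetSum _ fun a _ => hm a).aemeasurable,
    covariance_fun_sum_fun_sum hm hm]
  simp only [dotProduct, Matrix.mulVec, Matrix.of_apply, Finset.mul_sum]
  refine Finset.sum_congr rfl fun a _ => Finset.sum_congr rfl fun b _ => ?_
  rw [covariance_const_mul_left, covariance_const_mul_right]
  ring

lemma posSemidef_covMatrix_of_memLp {Ω : Type*} [MeasurableSpace Ω] {P : Measure Ω}
    [IsProbabilityMeasure P] {Z : ι → Ω → ℝ} (hZ : ∀ a, MemLp (Z a) 2 P) :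
    (Matrix.of fun a b => cov[Z a, Z b; P] : Matrix ι ι ℝ).PosSemidef := by
  refine Matrix.PosSemidef.of_dotProduct_mulVec_nonneg ?_ fun t => ?_
  · ext a b
    simp [covariance_comm]
  · rw [star_trivial, dotProduct_covMatrix_mulVec hZ]
    exact variance_nonneg _ _

/-- The multivariate central limit theorem: by Lévy's continuity theorem it is enough to look at
the characteristic function at `t`, which is that of the real variables `⟪·, t⟫` at `1`. -/
theorem tendstoInDistribution_sqrt_smul_mean_sub {Ω : Type*} [MeasurableSpace Ω] {P : Measure Ω}
    [IsProbabilityMeasure P] {Z : ℕ → Ω → EuclideanSpace ℝ ι}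
    (hL2 : ∀ a, MemLp (fun ω => Z 0 ω a) 2 P) (hindep : iIndepFun Z P)
    (hident : ∀ i, IdentDistrib (Z i) (Z 0) P P) {S : Matrix ι ι ℝ} {m : EuclideanSpace ℝ ι}
    (hS : ∀ a b, S a b = cov[fun ω => Z 0 ω a, fun ω => Z 0 ω b; P])
    (hm : ∀ a, m a = ∫ ω, Z 0 ω a ∂P) :
    TendstoInDistribution
      (fun (n : ℕ) ω => √(n : ℝ) • ((n : ℝ)⁻¹ • ∑ i ∈ Finset.range n, Z i ω - m)) atTop id
      (fun _ => P) (multivariateGaussian 0 S) := by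
  have hSeq : S = Matrix.of fun a b => cov[fun ω => Z 0 ω a, fun ω => Z 0 ω b; P] := by
    ext a b
    exact hS a b
  have hpsd : S.PosSemidef := hSeq ▸ posSemidef_covMatrix_of_memLp hL2
  have hmeas : ∀ i, AEMeasurable (Z i) P := fun i => (hident i).aemeasurable_fst
  have hWmeas : ∀ n : ℕ, AEMeasurable
      (fun ω => √(n : ℝ) • ((n : ℝ)⁻¹ • ∑ i ∈ Finset.range n, Z i ω - m)) P := fun n => by
    have := Finset.aemeasurable_fun_sum (Finset.range n) fun i _ => hmeas i
    fun_prop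
  refine ⟨hWmeas, aemeasurable_id, ?_⟩
  refine ProbabilityMeasure.tendsto_iff_tendsto_charFun.2 fun t => ?_
  have hcont : Measurable fun x : EuclideanSpace ℝ ι => ⟪x, t⟫ := by fun_prop
  have hsum : ∀ ω, ⟪Z 0 ω, t⟫ = ∑ a, t a * Z 0 ω a := fun ω => by
    simp [PiLp.inner_apply]
  have hXL2 : MemLp (fun ω => ⟪Z 0 ω, t⟫) 2 P := by
    simp only [hsum]
    exact memLp_finsetSum _ fun a _ => (hL2 a).const_mul (t a)
  have hmean : ∫ ω, ⟪Z 0 ω, t⟫ ∂P = ⟪m, t⟫ := by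
    simp only [hsum]
    rw [integral_finsetSum _ fun a _ => ((hL2 a).const_mul (t a)).integrable one_le_two]
    simp [PiLp.inner_apply, hm, integral_const_mul]
  have hvar : Var[fun ω => ⟪Z 0 ω, t⟫; P] = t ⬝ᵥ S *ᵥ t := by
    simp only [hsum]
    rw [hSeq, dotProduct_covMatrix_mulVec hL2]
  have hclt := tendstoInDistribution_inv_sqrt_mul_sum_sub (P := P)
    (X := fun i ω => ⟪Z i ω, t⟫) (HasLaw.id (μ := gaussianReal 0
      Var[fun ω => ⟪Z 0 ω, t⟫; P].toNNReal)) hXL2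
    (hindep.comp (fun _ x => ⟪x, t⟫) fun _ => hcont) (fun i => (hident i).comp hcont)
  have hlim := ProbabilityMeasure.tendsto_iff_tendsto_charFun.1 hclt.tendsto 1
  simp only [ProbabilityMeasure.coe_mk, Measure.map_id] at hlim ⊢
  rw [charFun_multivariateGaussian hpsd]
  rw [charFun_gaussianReal, hvar, Real.coe_toNNReal _ (hvar ▸ variance_nonneg _ _)] at hlim
  convert! hlim using 2 with n
  · rw [charFun_apply, charFun_apply_real, integral_map, integral_map]
    · refine integral_congr_ae (ae_of_all _ fun ω => ?_)
      have hreal : ⟪√(n : ℝ) • ((n : ℝ)⁻¹ • ∑ i ∈ Finset.range n, Z i ω - m), t⟫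
          = (√(n : ℝ))⁻¹ * (∑ k ∈ Finset.range n, ⟪Z k ω, t⟫ - n * ∫ ω, ⟪Z 0 ω, t⟫ ∂P) := by
        rw [hmean, real_inner_smul_left, inner_sub_left, real_inner_smul_left, sum_inner]
        rcases Nat.eq_zero_or_pos n with rfl | hn
        -- for `n = 0` both sides vanish, since `√0 = 0` and `(√0)⁻¹ = 0`
        · simp
        · have hn' : (0 : ℝ) < n := by exact_mod_cast hn
          have h2 : √(n : ℝ) * √(n : ℝ) = n := Real.mul_self_sqrt hn'.le
          have h3 : √(n : ℝ) ≠ 0 := (Real.sqrt_pos.2 hn').ne'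
          field_simp
          rw [sq, h2]
      simp only [hreal]
      simp
    · exact hclt.forall_aemeasurable n
    · fun_prop
    · exact hWmeas n
    · fun_prop
  · simp

lemma map_multivariateGaussian_zero {S : Matrix κ κ ℝ} (hS : S.PosSemidef)
    (L : EuclideanSpace ℝ κ →L[ℝ] EuclideanSpace ℝ ι) :
    (multivariateGaussian 0 S).map L
      = multivariateGaussian 0
        (PolyIV.stdMatrix L * S * (PolyIV.stdMatrix L).transpose) := by
  have hpsd : (PolyIV.stdMatrix L * S * (PolyIV.stdMatrix L).transpose).PosSemidef := by
    simpa using hS.mul_mul_conjTranspose_same (PolyIV.stdMatrix L)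
  have : IsProbabilityMeasure ((multivariateGaussian 0 S).map L) :=
    Measure.isProbabilityMeasure_map L.continuous.aemeasurable
  refine Measure.ext_of_charFun (funext fun t => ?_)
  have hinner : ∀ x, ⟪L x, t⟫ = ⟪x, WithLp.toLp 2 ((PolyIV.stdMatrix L)ᵀ *ᵥ t.ofLp)⟫ := by
    intro x
    rw [PolyIV.apply_eq_stdMatrix_mulVec L x]
    simp only [EuclideanSpace.inner_eq_star_dotProduct, star_trivial]
    rw [Matrix.dotProduct_mulVec, ← Matrix.mulVec_transpose]
  have : charFun ((multivariateGaussian 0 S).map L) t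
      = charFun (multivariateGaussian 0 S)
        (WithLp.toLp 2 ((PolyIV.stdMatrix L)ᵀ *ᵥ t.ofLp)) := by
    rw [charFun_apply, charFun_apply, integral_map L.continuous.aemeasurable (by fun_prop)]
    simp only [hinner]
  rw [this, charFun_multivariateGaussian hpsd, charFun_multivariateGaussian hS]
  congr 4
  · simp
  · rw [← Matrix.mulVec_mulVec, ← Matrix.mulVec_mulVec, Matrix.dotProduct_mulVec t.ofLp,
      ← Matrix.mulVec_transpose]

end CentralLimit

/-! ### The cell statistics -/

namespace PolyIV

section Statistics

variable {K : ℕ}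

lemma measurable_cellPow (j : ℕ) (l : Fin 2) (k : Fin K) :
    Measurable (cellPow j l k : Obs K → ℝ) := by
  unfold cellPow
  refine Measurable.ite ?_ (by fun_prop) measurable_const
  exact ((measurable_fst.comp measurable_snd) (measurableSet_singleton l)).inter
    (measurable_fst (measurableSet_singleton k))

lemma measurable_instrInd (l : Fin 2) : Measurable (instrInd l : Obs K → ℝ) := by
  unfold instrInd
  exact Measurable.ite ((measurable_fst.comp measurable_snd) (measurableSet_singleton l))
    measurable_const measurable_const

lemma measurable_statVec_apply (a : Coord K) : Measurable fun o : Obs K => statVec o a := by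
  rcases a with a | l
  · exact measurable_cellPow _ _ _
  · exact measurable_instrInd l

lemma measurable_statVec : Measurable (statVec : Obs K → CoefVec K) :=
  (WithLp.measurable_toLp 2 _).comp (measurable_pi_lambda _ measurable_statVec_apply)

lemma abs_cellPow_le {j M : ℕ} (hj : j ≤ M) (l : Fin 2) (k : Fin K) (o : Obs K) :
    |cellPow j l k o| ≤ 1 + |cellPow M l k o| := by
  unfold cellPow
  split_ifs
  · rw [abs_pow, abs_pow]
    rcases le_total |o.2.2| 1 with h | h
    · exact (pow_le_one₀ (abs_nonneg _) h).trans (le_add_of_nonneg_right (by positivity))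
    · exact (pow_le_pow_right₀ h hj).trans (le_add_of_nonneg_left zero_le_one)
  · simp

lemma sq_cellPow (j : ℕ) (l : Fin 2) (k : Fin K) (o : Obs K) :
    cellPow j l k o ^ 2 = cellPow (2 * j) l k o := by
  unfold cellPow
  split_ifs
  · rw [← pow_mul, mul_comm]
  · simp

/-- The binomial theorem in the cell that contains the observation. -/
lemma indicator_pow_eq_sum (l : Fin 2) (h : Vec K) (m : ℕ) (o : Obs K) :
    (if o.2.1 = l then (o.2.2 - h o.1) ^ m else 0)
      = ∑ k : Fin K, ∑ j ∈ Finset.range (m + 1),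
        (m.choose j : ℝ) * cellPow j l k o * (-(h k)) ^ (m - j) := by
  by_cases hl : o.2.1 = l
  · rw [if_pos hl, Finset.sum_eq_single o.1]
    · rw [sub_eq_add_neg, add_pow]
      refine Finset.sum_congr rfl fun j _ => ?_
      simp only [cellPow, hl, and_self, if_true]
      ring
    · intro k _ hk
      refine Finset.sum_eq_zero fun j _ => ?_
      simp [cellPow, hk.symm]
    · simp
  · rw [if_neg hl]
    symm
    refine Finset.sum_eq_zero fun k _ => Finset.sum_eq_zero fun j _ => ?_
    simp [cellPow, hl]

end Statistics

/-! ### Dependence of the polynomials on coefficients and argument -/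

section Polynomial

variable {K : ℕ}

lemma polyP_congr {Q Q' : ℕ → Fin 2 → Fin K → ℝ} {m M : ℕ} (hm : m ≤ M) (hM : 1 ≤ M)
    (hQ : ∀ j ≤ M, ∀ l k, Q j l k = Q' j l k) (h : Vec K) : polyP Q m h = polyP Q' m h := by
  unfold polyP
  split_ifs
  · refine Finset.sum_congr rfl fun k _ => Finset.sum_congr rfl fun j hj => ?_
    rw [hQ j (by have := Finset.mem_range.1 hj; omega)]
  · refine Finset.sum_congr rfl fun k _ => Finset.sum_congr rfl fun j hj => ?_
    have : j ≤ M := by have := Finset.mem_range.1 hj; omega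
    rw [hQ j this, hQ j this]

lemma tendsto_polyP {ι : Type*} {f : Filter ι} {Q : ι → ℕ → Fin 2 → Fin K → ℝ}
    {Q' : ℕ → Fin 2 → Fin K → ℝ} {h : ι → Vec K} {h' : Vec K} {m M : ℕ} (hm : m ≤ M) (hM : 1 ≤ M)
    (hQ : ∀ j ≤ M, ∀ l k, Tendsto (fun i => Q i j l k) f (𝓝 (Q' j l k)))
    (hh : Tendsto h f (𝓝 h')) :
    Tendsto (fun i => polyP (Q i) m (h i)) f (𝓝 (polyP Q' m h')) := by
  have hc : ∀ k, Tendsto (fun i => h i k) f (𝓝 (h' k)) := fun k =>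
    ((EuclideanSpace.proj (𝕜 := ℝ) k).continuous.tendsto h').comp hh
  unfold polyP
  split_ifs
  · refine tendsto_finsetSum _ fun k _ => tendsto_finsetSum _ fun j hj => ?_
    exact (hQ j (by have := Finset.mem_range.1 hj; omega) 0 k).mul ((hc k).neg.pow _)
  · refine tendsto_finsetSum _ fun k _ => tendsto_finsetSum _ fun j hj => ?_
    have hjM : j ≤ M := by have := Finset.mem_range.1 hj; omega
    exact (((hQ j hjM 0 k).sub (hQ j hjM 1 k)).const_mul _).mul ((hc k).neg.pow _)

lemma contDiffAt_Psi {w : CoefVec K} (hw : ∀ l, w (Sum.inr l) ≠ 0) (v : Vec K) :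
    ContDiffAt ℝ 1 (fun p : CoefVec K × Vec K => Psi p.2 p.1) (w, v) := by
  have hQ : ∀ (j : ℕ) (l : Fin 2) (k : Fin K), ContDiffAt ℝ 1 (fun p : CoefVec K × Vec K =>
      if hj : j < K then p.1 (Sum.inl (⟨j, hj⟩, l, k)) / p.1 (Sum.inr l) else 0) (w, v) := by
    intro j l k
    split_ifs with hj
    · exact ContDiffAt.div (by fun_prop) (by fun_prop) (hw l)
    · exact contDiffAt_const
  have hh : ∀ (k : Fin K) (i : ℕ),
      ContDiffAt ℝ 1 (fun p : CoefVec K × Vec K => (-(p.2 k)) ^ i) (w, v) := by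
    intro k i
    fun_prop
  refine contDiffAt_euclidean.2 fun m => ?_
  simp only [Psi, polyP]
  split_ifs
  · exact ContDiffAt.sum fun k _ => ContDiffAt.sum fun j _ => (hQ j 0 k).mul (hh k _)
  · exact ContDiffAt.sum fun k _ => ContDiffAt.sum fun j _ =>
      (contDiffAt_const.mul ((hQ j 0 k).sub (hQ j 1 k))).mul (hh k _)

/-- `Psi v w` only involves the moments of order less than `K`; `2 ≤ K` is what makes this true of
the coordinate `m = 0`, which uses the first moment. -/
lemma Psi_eq_of_forall {w : CoefVec K} (hK : 2 ≤ K) {Q : ℕ → Fin 2 → Fin K → ℝ}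
    (hQ : ∀ (j : Fin K) l k, Q j l k = w (Sum.inl (j, l, k)) / w (Sum.inr l)) (v : Vec K) :
    Psi v w = WithLp.toLp 2 fun m : Fin K => polyP Q (m : ℕ) v := by
  unfold Psi
  congr 1
  funext m
  refine polyP_congr (M := K - 1) (by omega) (by omega) (fun j hj l k => ?_) v
  have hjK : j < K := by omega
  rw [dif_pos hjK, ← hQ ⟨j, hjK⟩]

lemma lambdaHat_eq_Psi (hK : 2 ≤ K) {n : ℕ} (s : Fin n → Obs K) (v : Vec K) :
    lambdaHat s v = Psi v (wHat s) :=
  (Psi_eq_of_forall hK (fun _ _ _ => rfl) v).symm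

end Polynomial

/-! ### Population moments -/

section Population

variable {K : ℕ} {Ω₀ : Type*} [MeasurableSpace Ω₀] {P₀ : Measure Ω₀} [IsProbabilityMeasure P₀]
  {X : Ω₀ → Fin K} {W : Ω₀ → Fin 2} {Y : Ω₀ → ℝ}

/-- The population coefficients `Q j ℓ k = E[Y ^ j 1_{W = ℓ, X = k}] / P(W = ℓ)`, with `P(W = ℓ)`
written as the mean of `instrInd ℓ`, so that `qHat` is the empirical version. -/
noncomputable def popQ (P₀ : Measure Ω₀) (X : Ω₀ → Fin K) (W : Ω₀ → Fin 2) (Y : Ω₀ → ℝ)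
    (j : ℕ) (l : Fin 2) (k : Fin K) : ℝ :=
  (∫ ω, cellPow j l k (X ω, W ω, Y ω) ∂P₀) / ∫ ω, instrInd l (X ω, W ω, Y ω) ∂P₀

lemma integral_instrInd (hW : Measurable W) (l : Fin 2) :
    ∫ ω, instrInd l (X ω, W ω, Y ω) ∂P₀ = P₀.real (W ⁻¹' {l}) := by
  have h : (fun ω => instrInd l (X ω, W ω, Y ω)) = (W ⁻¹' {l}).indicator fun _ => (1 : ℝ) := by
    funext ω
    by_cases hl : W ω = l <;> simp [instrInd, hl]
  rw [h, integral_indicator_const _ (hW (measurableSet_singleton l)), smul_eq_mul, mul_one]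

lemma integrable_instrInd (hX : Measurable X) (hW : Measurable W) (hY : Measurable Y) (l : Fin 2) :
    Integrable (fun ω => instrInd l (X ω, W ω, Y ω)) P₀ := by
  refine Integrable.of_bound (C := 1)
    ((measurable_instrInd l).comp (hX.prodMk (hW.prodMk hY))).aestronglyMeasurable
    (ae_of_all _ fun ω => ?_)
  unfold instrInd
  split_ifs <;> simp

lemma integrable_cellPow_of_le (hX : Measurable X) (hW : Measurable W) (hY : Measurable Y)
    {l : Fin 2} {k : Fin K} {j M : ℕ} (hj : j ≤ M)
    (hM : Integrable (fun ω => cellPow M l k (X ω, W ω, Y ω)) P₀) :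
    Integrable (fun ω => cellPow j l k (X ω, W ω, Y ω)) P₀ := by
  refine ((integrable_const (1 : ℝ)).add hM.abs).mono'
    ((measurable_cellPow j l k).comp (hX.prodMk (hW.prodMk hY))).aestronglyMeasurable
    (ae_of_all _ fun ω => ?_)
  exact abs_cellPow_le hj l k _

/-- A conditional moment given a cell is an unconditional moment restricted to the cell. Cells of
probability zero are harmless, for there the restricted moment vanishes. -/
lemma integrable_cellPow_of_cond (hX : Measurable X) (hW : Measurable W) (hY : Measurable Y)
    {M : ℕ} {l : Fin 2} {k : Fin K}
    (hmom : Integrable (fun ω => |Y ω| ^ M) (P₀[|W ⁻¹' {l} ∩ X ⁻¹' {k}])) :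
    Integrable (fun ω => cellPow M l k (X ω, W ω, Y ω)) P₀ := by
  have hs : MeasurableSet (W ⁻¹' {l} ∩ X ⁻¹' {k}) :=
    (hW (measurableSet_singleton l)).inter (hX (measurableSet_singleton k))
  have heq : (fun ω => cellPow M l k (X ω, W ω, Y ω))
      = (W ⁻¹' {l} ∩ X ⁻¹' {k}).indicator fun ω => Y ω ^ M := by
    funext ω
    by_cases hl : W ω = l <;> by_cases hk : X ω = k <;> simp [cellPow, hl, hk]
  rw [heq, integrable_indicator_iff hs, IntegrableOn]
  have habs : Integrable (fun ω => |Y ω| ^ M) (P₀.restrict (W ⁻¹' {l} ∩ X ⁻¹' {k})) := by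
    by_cases h0 : P₀ (W ⁻¹' {l} ∩ X ⁻¹' {k}) = 0
    · rw [Measure.restrict_eq_zero.2 h0]
      exact integrable_zero_measure
    · rw [ProbabilityTheory.cond] at hmom
      exact (integrable_smul_measure (ENNReal.inv_ne_zero.2 (measure_ne_top _ _))
        (ENNReal.inv_ne_top.2 h0)).1 hmom
  refine habs.mono' (hY.pow_const M).aestronglyMeasurable (ae_of_all _ fun ω => ?_)
  simp

lemma integral_cond_pow_eq_sum (hW : Measurable W) {M : ℕ}
    (hint : ∀ j ≤ M, ∀ l k, Integrable (fun ω => cellPow j l k (X ω, W ω, Y ω)) P₀)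
    (l : Fin 2) (h : Vec K) {m : ℕ} (hm : m ≤ M) :
    ∫ ω, (Y ω - h (X ω)) ^ m ∂(P₀[|W ⁻¹' {l}])
      = ∑ k : Fin K, ∑ j ∈ Finset.range (m + 1),
        (m.choose j : ℝ) * popQ P₀ X W Y j l k * (-(h k)) ^ (m - j) := by
  have hs : MeasurableSet (W ⁻¹' {l}) := hW (measurableSet_singleton l)
  have hterm : ∀ k : Fin K, ∀ j ∈ Finset.range (m + 1), Integrable (fun ω =>
      (m.choose j : ℝ) * cellPow j l k (X ω, W ω, Y ω) * (-(h k)) ^ (m - j)) P₀ := by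
    intro k j hj
    have := Finset.mem_range.1 hj
    exact ((hint j (by omega) l k).const_mul _).mul_const _
  have hind : (W ⁻¹' {l}).indicator (fun ω => (Y ω - h (X ω)) ^ m)
      = fun ω => ∑ k : Fin K, ∑ j ∈ Finset.range (m + 1),
        (m.choose j : ℝ) * cellPow j l k (X ω, W ω, Y ω) * (-(h k)) ^ (m - j) := by
    funext ω
    rw [← indicator_pow_eq_sum l h m (X ω, W ω, Y ω)]
    by_cases hl : W ω = l <;> simp [hl]
  rw [ProbabilityTheory.cond, integral_smul_measure, ← integral_indicator hs, hind,
    integral_finsetSum _ fun k _ => integrable_finsetSum _ (hterm k), smul_eq_mul, Finset.mul_sum]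
  refine Finset.sum_congr rfl fun k _ => ?_
  rw [integral_finsetSum _ (hterm k), Finset.mul_sum]
  refine Finset.sum_congr rfl fun j _ => ?_
  rw [integral_mul_const, integral_const_mul, popQ, integral_instrInd hW, ENNReal.toReal_inv,
    div_eq_inv_mul, measureReal_def]
  ring

lemma popP_eq_polyP (hW : Measurable W) {M : ℕ} (hM : 1 ≤ M)
    (hint : ∀ j ≤ M, ∀ l k, Integrable (fun ω => cellPow j l k (X ω, W ω, Y ω)) P₀)
    {m : ℕ} (hm : m ≤ M) (h : Vec K) : popP P₀ X W Y m h = polyP (popQ P₀ X W Y) m h := by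
  unfold popP polyP
  split_ifs with hm0
  · have := integral_cond_pow_eq_sum (P₀ := P₀) hW hint 0 h hM
    simp only [pow_one] at this
    rw [this]
    refine Finset.sum_congr rfl fun k _ => Finset.sum_congr rfl fun j hj => ?_
    have : j ≤ 1 := by have := Finset.mem_range.1 hj; omega
    interval_cases j <;> simp
  · rw [integral_cond_pow_eq_sum hW hint 0 h hm, integral_cond_pow_eq_sum hW hint 1 h hm,
      ← Finset.sum_sub_distrib]
    refine Finset.sum_congr rfl fun k _ => ?_
    rw [← Finset.sum_sub_distrib]
    refine Finset.sum_congr rfl fun j _ => ?_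
    ring

lemma popLambda_eq_Psi (hK : 2 ≤ K) (hW : Measurable W)
    (hint : ∀ j ≤ K + 1, ∀ l k, Integrable (fun ω => cellPow j l k (X ω, W ω, Y ω)) P₀)
    (v : Vec K) : popLambda P₀ X W Y v = Psi v (wStar P₀ X W Y) := by
  rw [Psi_eq_of_forall (Q := popQ P₀ X W Y) hK fun _ _ _ => rfl, popLambda]
  congr 1
  funext m
  exact popP_eq_polyP hW (by omega) hint (by omega) v

lemma wStar_inr_pos (hW : Measurable W) (hWpos : ∀ l : Fin 2, 0 < P₀ (W ⁻¹' {l})) (l : Fin 2) :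
    0 < wStar P₀ X W Y (Sum.inr l) := by
  change 0 < ∫ ω, instrInd l (X ω, W ω, Y ω) ∂P₀
  rw [integral_instrInd hW]
  exact ENNReal.toReal_pos (hWpos l).ne' (measure_ne_top _ _)

lemma memLp_statVec (hX : Measurable X) (hW : Measurable W) (hY : Measurable Y)
    (hint : ∀ (l : Fin 2) (k : Fin K),
      Integrable (fun ω => cellPow (2 * K - 2) l k (X ω, W ω, Y ω)) P₀) (a : Coord K) :
    MemLp (fun ω => statVec (X ω, W ω, Y ω) a) 2 P₀ := by
  have hmeas : AEStronglyMeasurable (fun ω => statVec (X ω, W ω, Y ω) a) P₀ :=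
    ((measurable_statVec_apply a).comp (hX.prodMk (hW.prodMk hY))).aestronglyMeasurable
  rw [memLp_two_iff_integrable_sq hmeas]
  rcases a with ⟨j, l, k⟩ | l
  · have : (fun ω => statVec (X ω, W ω, Y ω) (Sum.inl (j, l, k)) ^ 2)
        = fun ω => cellPow (2 * (j : ℕ)) l k (X ω, W ω, Y ω) := by
      funext ω
      exact sq_cellPow _ _ _ _
    rw [this]
    exact integrable_cellPow_of_le hX hW hY (by omega) (hint l k)
  · have : (fun ω => statVec (X ω, W ω, Y ω) (Sum.inr l) ^ 2)
        = fun ω => instrInd l (X ω, W ω, Y ω) := by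
      funext ω
      simp [statVec, instrInd]
    rw [this]
    exact integrable_instrInd hX hW hY l

end Population

end PolyIV

/-! ### The delta method -/

section DeltaMethod

/-- The delta method for an estimator `G n` that eventually equals `f (T n)`. Dividing the
remainder of the first-order expansion by the norm of `√n • (T n - w)` gives a sequence that
tends to zero almost surely, so Slutsky's theorem applies to `(x, y) ↦ L x + ‖x‖ • y`, and no
measurability of `f` is needed. -/
theorem MeasureTheory.TendstoInDistribution.delta_method {E F Ω Ω' : Type*}
    [NormedAddCommGroup E] [NormedSpace ℝ E] [MeasurableSpace E] [BorelSpace E]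
    [SecondCountableTopology E]
    [NormedAddCommGroup F] [NormedSpace ℝ F] [MeasurableSpace F] [BorelSpace F]
    [SecondCountableTopology F]
    [MeasurableSpace Ω] {P : Measure Ω} [IsProbabilityMeasure P]
    [MeasurableSpace Ω'] {P' : Measure Ω'} [IsProbabilityMeasure P']
    {T : ℕ → Ω → E} {w : E} {Z : Ω' → E} {f : E → F} {L : E →L[ℝ] F} {G : ℕ → Ω → F}
    (hZ : TendstoInDistribution (fun (n : ℕ) ω => √(n : ℝ) • (T n ω - w)) atTop Z (fun _ => P) P')
    (hf : HasFDerivAt f L w) (hT : ∀ᵐ ω ∂P, Tendsto (fun n => T n ω) atTop (𝓝 w))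
    (hGm : ∀ n, AEMeasurable (G n) P) (hG : ∀ᵐ ω ∂P, ∀ᶠ n in atTop, G n ω = f (T n ω)) :
    TendstoInDistribution (fun (n : ℕ) ω => √(n : ℝ) • (G n ω - f w)) atTop (fun ω => L (Z ω))
      (fun _ => P) P' := by
  set D : ℕ → Ω → E := fun n ω => √(n : ℝ) • (T n ω - w) with hD
  set V : ℕ → Ω → F := fun n ω => √(n : ℝ) • (G n ω - f w) with hV
  have hDm : ∀ n, AEMeasurable (D n) P := hZ.forall_aemeasurable
  have hVm : ∀ n, AEMeasurable (V n) P := fun n => ((hGm n).sub_const _).const_smul _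
  set ρ : ℕ → Ω → F := fun n ω => ‖D n ω‖⁻¹ • (V n ω - L (D n ω)) with hρ
  have hLm : ∀ n, AEMeasurable (fun ω => L (D n ω)) P := fun n =>
    L.continuous.measurable.comp_aemeasurable (hDm n)
  have hρm : ∀ n, AEMeasurable (ρ n) P := fun n =>
    (hDm n).norm.inv.smul ((hVm n).sub (hLm n))
  have hρ0 : ∀ᵐ ω ∂P, Tendsto (fun n => ρ n ω) atTop (𝓝 0) := by
    filter_upwards [hT, hG] with ω hTω hGω
    rw [tendsto_zero_iff_norm_tendsto_zero]
    refine ((hasFDerivAt_iff_tendsto.1 hf).comp hTω).congr' ?_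
    filter_upwards [hGω, eventually_gt_atTop 0] with n hn hpos
    have hs : 0 < √(n : ℝ) := Real.sqrt_pos.2 (by exact_mod_cast hpos)
    have hVD : V n ω - L (D n ω) = √(n : ℝ) • (f (T n ω) - f w - L (T n ω - w)) := by
      change √(n : ℝ) • (G n ω - f w) - L (√(n : ℝ) • (T n ω - w)) = _
      rw [hn, map_smul, ← smul_sub]
    have hDn : ‖D n ω‖ = √(n : ℝ) * ‖T n ω - w‖ := by
      rw [hD, norm_smul, Real.norm_of_nonneg hs.le]
    change _ = ‖‖D n ω‖⁻¹ • (V n ω - L (D n ω))‖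
    rw [norm_smul, norm_inv, norm_norm, hDn, hVD, norm_smul, Real.norm_of_nonneg hs.le, mul_inv,
      mul_mul_mul_comm, inv_mul_cancel₀ hs.ne', one_mul, Function.comp_apply]
  have hslutsky : TendstoInDistribution (fun n ω => L (D n ω) + ‖D n ω‖ • ρ n ω) atTop
      (fun ω => L (Z ω) + ‖Z ω‖ • (0 : F)) (fun _ => P) P' :=
    hZ.continuous_comp_prodMk_of_tendstoInMeasure_const
      (g := fun x : E × F => L x.1 + ‖x.1‖ • x.2) (by fun_prop)
      (tendstoInMeasure_of_tendsto_ae (fun n => (hρm n).aestronglyMeasurable) hρ0) hρm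
  simp only [smul_zero, add_zero] at hslutsky
  refine tendstoInDistribution_of_tendstoInMeasure_sub V _ hslutsky ?_ hVm
  refine tendstoInMeasure_of_tendsto_ae (fun n => ?_) ?_
  · exact ((hVm n).sub ((hLm n).add ((hDm n).norm.smul (hρm n)))).aestronglyMeasurable
  · filter_upwards [hG] with ω hGω
    refine tendsto_const_nhds.congr' ?_
    filter_upwards [hGω, eventually_gt_atTop 0] with n hn hpos
    have hs : 0 < √(n : ℝ) := Real.sqrt_pos.2 (by exact_mod_cast hpos)
    rcases eq_or_ne (D n ω) 0 with h0 | h0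
    -- here `‖D n ω‖⁻¹` is the junk value `0`, but then `T n ω = w` and both sides vanish
    · have hTw : T n ω = w := by
        have := (smul_eq_zero.1 h0).resolve_left hs.ne'
        exact sub_eq_zero.1 this
      simp [hV, hn, hTw, h0]
    · simp [hρ, smul_smul, mul_inv_cancel₀ (norm_ne_zero_iff.2 h0)]

end DeltaMethod

/-! ### Deterministic consistency argument -/

namespace PolyIV

section Consistency

variable {K : ℕ}

lemma tendsto_gammaHat {ι : Type*} {f : Filter ι} {n : ι → ℕ} {s : ∀ n, Fin n → Obs K}
    {Q : ℕ → Fin 2 → Fin K → ℝ}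
    (hQ : ∀ j ≤ K + 1, ∀ l k, Tendsto (fun i => qHat (s (n i)) j l k) f (𝓝 (Q j l k)))
    {h : ι → Vec K} {h' : Vec K} (hh : Tendsto h f (𝓝 h')) :
    Tendsto (fun i => gammaHat (s (n i)) (h i)) f
      (𝓝 (WithLp.toLp 2 fun m : Fin (K + 2) => polyP Q (m : ℕ) h')) := by
  refine ((PiLp.continuous_toLp 2 _).tendsto _).comp (tendsto_pi_nhds.2 fun m => ?_)
  exact tendsto_polyP (M := K + 1) (by omega) (by omega) hQ hh

/-- Consistency of the two-stage estimator along one realization of the sample. If the empirical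
`Λ` has zeros `z n` that converge to `g`, then they are feasible in the second stage, so the
minimum of the empirical `Γ` tends to `0`; every limit point of the estimator, which lives in a
compact ball, is then a zero of the population `Γ`, and `g` is the only one. -/
theorem tendsto_of_isTwoStage {s : ∀ n, Fin n → Obs K} {Q : ℕ → Fin 2 → Fin K → ℝ} {g : Vec K}
    {R : ℝ}
    (hQ : ∀ j ≤ K + 1, ∀ l k, Tendsto (fun n => qHat (s n) j l k) atTop (𝓝 (Q j l k)))
    (hid : ∀ h : Vec K,
      (WithLp.toLp 2 fun m : Fin (K + 2) => polyP Q (m : ℕ) h) = 0 ↔ h = g)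
    (hR : ‖g‖ < R) {z h : ℕ → Vec K} (hz : Tendsto z atTop (𝓝 g))
    (hz0 : ∀ᶠ n in atTop, lambdaHat (s n) (z n) = 0)
    (hh : ∀ᶠ n in atTop, IsTwoStage R (s n) (h n)) :
    Tendsto h atTop (𝓝 g) ∧ ∀ᶠ n in atTop, lambdaHat (s n) (h n) = 0 := by
  have hzR : ∀ᶠ n in atTop, ‖z n‖ ≤ R := by
    filter_upwards [hz.norm.eventually (gt_mem_nhds hR)] with n hn using hn.le
  have hkey : ∀ᶠ n in atTop, (‖h n‖ ≤ R ∧ lambdaHat (s n) (h n) = 0) ∧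
      ‖gammaHat (s n) (h n)‖ ≤ ‖gammaHat (s n) (z n)‖ := by
    filter_upwards [hzR, hz0, hh] with n hn1 hn2 hn3
    have hset : zeroSet R (lambdaHat (s n)) = {v | ‖v‖ ≤ R ∧ lambdaHat (s n) v = 0} :=
      if_pos ⟨z n, hn1, hn2⟩
    obtain ⟨hmem, hmin⟩ := hn3
    rw [hset] at hmem hmin
    exact ⟨hmem, hmin ⟨hn1, hn2⟩⟩
  have hgamma : Tendsto (fun n => gammaHat (s n) (h n)) atTop (𝓝 0) := by
    have hzlim := tendsto_gammaHat (n := fun i : ℕ => i) hQ hz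
    rw [(hid g).2 rfl] at hzlim
    exact squeeze_zero_norm' (hkey.mono fun n hn => hn.2)
      (tendsto_zero_iff_norm_tendsto_zero.1 hzlim)
  refine ⟨tendsto_of_subseq_tendsto fun ns hns => ?_, hkey.mono fun n hn => hn.1.2⟩
  have hball : ∀ᶠ i in atTop, h (ns i) ∈ Metric.closedBall (0 : Vec K) R := by
    filter_upwards [hns.eventually hkey] with i hi
    simpa using hi.1.1
  obtain ⟨a, -, φ, hφ, ha⟩ :=
    (isCompact_closedBall (0 : Vec K) R).tendsto_subseq' hball.frequently
  have hsub : Tendsto (fun i => ns (φ i)) atTop atTop := hns.comp hφ.tendsto_atTop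
  have hlim := tendsto_gammaHat (n := fun i => ns (φ i))
    (fun j hj l k => (hQ j hj l k).comp hsub) ha
  have ha0 : a = g := (hid a).1 (tendsto_nhds_unique hlim (hgamma.comp hsub))
  exact ⟨φ, ha0 ▸ ha⟩

end Consistency

/-! ### Limit theorems for the sample -/

section Sample

variable {K : ℕ} {Ω₀ Ω : Type*} [MeasurableSpace Ω₀] {P₀ : Measure Ω₀} [IsProbabilityMeasure P₀]
  {X : Ω₀ → Fin K} {W : Ω₀ → Fin 2} {Y : Ω₀ → ℝ}
  [MeasurableSpace Ω] {P : Measure Ω} [IsProbabilityMeasure P] {S : ℕ → Ω → Obs K}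

lemma wHat_eq_smul_sum (ω : Ω) (n : ℕ) :
    wHat (fun i : Fin n => S i ω)
      = (n : ℝ)⁻¹ • ∑ i ∈ Finset.range n, statVec (S i ω) := by
  ext a
  simp [wHat, sampleMean, Finset.sum_range]

lemma ae_tendsto_sampleMean (hindep : iIndepFun S P)
    (hident : ∀ i, IdentDistrib (S i) (fun ω => (X ω, W ω, Y ω)) P P₀) {f : Obs K → ℝ}
    (hf : Measurable f) (hint : Integrable (fun ω => f (X ω, W ω, Y ω)) P₀) :
    ∀ᵐ ω ∂P, Tendsto (fun n : ℕ => sampleMean (fun i : Fin n => S i ω) f) atTop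
      (𝓝 (∫ ω, f (X ω, W ω, Y ω) ∂P₀)) := by
  have hid : ∀ i, IdentDistrib (fun ω => f (S i ω)) (fun ω => f (X ω, W ω, Y ω)) P P₀ :=
    fun i => (hident i).comp hf
  have hslln := strong_law_ae (μ := P) (fun i ω => f (S i ω)) ((hid 0).integrable_iff.2 hint)
    (fun i j hij => (hindep.indepFun hij).comp hf hf) (fun i => (hid i).trans (hid 0).symm)
  rw [(hid 0).integral_eq] at hslln
  filter_upwards [hslln] with ω hω
  simpa [sampleMean, Finset.sum_range] using hω

lemma integrable_statVec (hX : Measurable X) (hW : Measurable W) (hY : Measurable Y)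
    (hint : ∀ j ≤ K + 1, ∀ l k, Integrable (fun ω => cellPow j l k (X ω, W ω, Y ω)) P₀)
    (a : Coord K) : Integrable (fun ω => statVec (X ω, W ω, Y ω) a) P₀ := by
  rcases a with ⟨j, l, k⟩ | l
  · exact hint j (by omega) l k
  · exact integrable_instrInd hX hW hY l

lemma ae_tendsto_wHat (hX : Measurable X) (hW : Measurable W) (hY : Measurable Y)
    (hindep : iIndepFun S P)
    (hident : ∀ i, IdentDistrib (S i) (fun ω => (X ω, W ω, Y ω)) P P₀)
    (hint : ∀ j ≤ K + 1, ∀ l k, Integrable (fun ω => cellPow j l k (X ω, W ω, Y ω)) P₀) :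
    ∀ᵐ ω ∂P, Tendsto (fun n : ℕ => wHat (fun i : Fin n => S i ω)) atTop
      (𝓝 (wStar P₀ X W Y)) := by
  have h := ae_all_iff.2 fun a => ae_tendsto_sampleMean hindep hident (measurable_statVec_apply a)
    (integrable_statVec hX hW hY hint a)
  filter_upwards [h] with ω hω
  exact ((PiLp.continuous_toLp 2 _).tendsto _).comp (tendsto_pi_nhds.2 hω)

lemma ae_tendsto_qHat (hX : Measurable X) (hW : Measurable W) (hY : Measurable Y)
    (hindep : iIndepFun S P)
    (hident : ∀ i, IdentDistrib (S i) (fun ω => (X ω, W ω, Y ω)) P P₀)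
    (hint : ∀ j ≤ K + 1, ∀ l k, Integrable (fun ω => cellPow j l k (X ω, W ω, Y ω)) P₀)
    (hWpos : ∀ l : Fin 2, 0 < P₀ (W ⁻¹' {l})) :
    ∀ᵐ ω ∂P, ∀ j ≤ K + 1, ∀ l k,
      Tendsto (fun n : ℕ => qHat (fun i : Fin n => S i ω) j l k) atTop
        (𝓝 (popQ P₀ X W Y j l k)) := by
  refine ae_all_iff.2 fun j => ?_
  by_cases hj : j ≤ K + 1
  · have h := ae_all_iff.2 fun l => ae_all_iff.2 fun k =>
      (ae_tendsto_sampleMean hindep hident (measurable_cellPow j l k) (hint j hj l k)).and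
        (ae_tendsto_sampleMean hindep hident (measurable_instrInd l)
          (integrable_instrInd hX hW hY l))
    filter_upwards [h] with ω hω _ l k
    exact (hω l k).1.div (hω l k).2 (wStar_inr_pos (X := X) (Y := Y) hW hWpos l).ne'
  · exact ae_of_all _ fun ω h => absurd h hj

lemma ae_eventually_exists_instr (hX : Measurable X) (hW : Measurable W) (hY : Measurable Y)
    (hindep : iIndepFun S P)
    (hident : ∀ i, IdentDistrib (S i) (fun ω => (X ω, W ω, Y ω)) P P₀)
    (hWpos : ∀ l : Fin 2, 0 < P₀ (W ⁻¹' {l})) :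
    ∀ᵐ ω ∂P, ∀ᶠ n : ℕ in atTop, ∀ l : Fin 2, ∃ i : Fin n, (S i ω).2.1 = l := by
  have h := ae_all_iff.2 fun l => ae_tendsto_sampleMean hindep hident (measurable_instrInd l)
    (integrable_instrInd (P₀ := P₀) hX hW hY l)
  filter_upwards [h] with ω hω
  refine eventually_all.2 fun l => ?_
  filter_upwards [(hω l).eventually (lt_mem_nhds (wStar_inr_pos (X := X) (Y := Y) hW hWpos l))]
    with n hn
  by_contra! hne
  refine hn.ne' ?_
  simp [sampleMean, instrInd, hne]

/-- Almost surely the two-stage estimator converges to `g`, and it eventually equals the implicit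
function at the sample means. -/
theorem ae_twoStage_eq_implicit (hK : 2 ≤ K)
    (hX : Measurable X) (hW : Measurable W) (hY : Measurable Y)
    (hindep : iIndepFun S P)
    (hident : ∀ i, IdentDistrib (S i) (fun ω => (X ω, W ω, Y ω)) P P₀)
    (hint : ∀ j ≤ K + 1, ∀ l k, Integrable (fun ω => cellPow j l k (X ω, W ω, Y ω)) P₀)
    (hWpos : ∀ l : Fin 2, 0 < P₀ (W ⁻¹' {l}))
    {g : Vec K} {R : ℝ} (hid : ∀ h : Vec K, popGamma P₀ X W Y h = 0 ↔ h = g) (hR : ‖g‖ < R)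
    {gt : ℕ → Ω → Vec K}
    (hgt : ∀ n ω, (∀ l : Fin 2, ∃ i : Fin n, (S i ω).2.1 = l) →
      IsTwoStage R (fun i : Fin n => S i ω) (gt n ω))
    {A : Set (Vec K)} {B : Set (CoefVec K)} {om : CoefVec K → Vec K}
    (hA : IsOpen A) (hB : IsOpen B) (hgA : g ∈ A) (hwB : wStar P₀ X W Y ∈ B)
    (hmaps : Set.MapsTo om B A) (hcont : ContinuousAt om (wStar P₀ X W Y))
    (hom : om (wStar P₀ X W Y) = g) (hiff : ∀ w ∈ B, ∀ v ∈ A, Psi v w = 0 ↔ v = om w) :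
    ∀ᵐ ω ∂P, Tendsto (fun n => gt n ω) atTop (𝓝 g) ∧
      ∀ᶠ n in atTop, gt n ω = om (wHat (fun i : Fin n => S i ω)) := by
  have hid' : ∀ h : Vec K,
      (WithLp.toLp 2 fun m : Fin (K + 2) => polyP (popQ P₀ X W Y) (m : ℕ) h) = 0 ↔ h = g := by
    intro h
    rw [← hid h, popGamma]
    have : ∀ m : Fin (K + 2), popP P₀ X W Y m h = polyP (popQ P₀ X W Y) m h := fun m =>
      popP_eq_polyP hW (by omega) hint (by omega) h
    simp only [this]
  filter_upwards [ae_tendsto_wHat hX hW hY hindep hident hint,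
    ae_tendsto_qHat hX hW hY hindep hident hint hWpos,
    ae_eventually_exists_instr (P₀ := P₀) hX hW hY hindep hident hWpos] with ω hw hQ hocc
  have hwB' : ∀ᶠ n : ℕ in atTop, wHat (fun i : Fin n => S i ω) ∈ B :=
    hw.eventually (hB.mem_nhds hwB)
  have hz : Tendsto (fun n : ℕ => om (wHat (fun i : Fin n => S i ω))) atTop (𝓝 g) := by
    have := hcont.tendsto.comp hw
    rwa [hom] at this
  obtain ⟨hlim, hzero⟩ := tendsto_of_isTwoStage (s := fun n (i : Fin n) => S i ω)
    (h := fun n => gt n ω) hQ hid' hR hz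
    (hwB'.mono fun n hn => by
      rw [lambdaHat_eq_Psi hK]
      exact (hiff _ hn _ (hmaps hn)).2 rfl)
    (hocc.mono fun n hn => hgt n ω hn)
  refine ⟨hlim, ?_⟩
  filter_upwards [hwB', hlim.eventually (hA.mem_nhds hgA), hzero] with n h1 h2 h3
  rw [lambdaHat_eq_Psi hK] at h3
  exact (hiff _ h1 _ h2).1 h3

theorem tendstoInDistribution_sqrt_smul_wHat_sub (hindep : iIndepFun S P)
    (hident : ∀ i, IdentDistrib (S i) (fun ω => (X ω, W ω, Y ω)) P P₀)
    (hL2 : ∀ a : Coord K, MemLp (fun ω => statVec (X ω, W ω, Y ω) a) 2 P₀) :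
    TendstoInDistribution
      (fun (n : ℕ) ω => √(n : ℝ) • (wHat (fun i : Fin n => S i ω) - wStar P₀ X W Y)) atTop id
      (fun _ => P) (multivariateGaussian 0 (matOmega P₀ X W Y)) := by
  have hid : ∀ i a, IdentDistrib (fun ω => statVec (S i ω) a)
      (fun ω => statVec (X ω, W ω, Y ω) a) P P₀ :=
    fun i a => (hident i).comp (measurable_statVec_apply a)
  have hL2S : ∀ a, MemLp (fun ω => statVec (S 0 ω) a) 2 P := fun a =>
    (hid 0 a).memLp_iff.2 (hL2 a)
  have h := tendstoInDistribution_sqrt_smul_mean_sub (P := P) (Z := fun i ω => statVec (S i ω))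
    (S := matOmega P₀ X W Y) (m := wStar P₀ X W Y) hL2S
    (hindep.comp (fun _ => statVec) fun _ => measurable_statVec)
    (fun i => ((hident i).trans (hident 0).symm).comp measurable_statVec) ?_ ?_
  · simpa only [wHat_eq_smul_sum] using h
  · intro a b
    have hab : IdentDistrib (fun ω => statVec (S 0 ω) a * statVec (S 0 ω) b)
        (fun ω => statVec (X ω, W ω, Y ω) a * statVec (X ω, W ω, Y ω) b) P P₀ :=
      (hident 0).comp ((measurable_statVec_apply a).mul (measurable_statVec_apply b))
    rw [matOmega, Matrix.of_apply, covariance_eq_sub (hL2 a) (hL2 b),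
      covariance_eq_sub (hL2S a) (hL2S b), (hid 0 a).integral_eq, (hid 0 b).integral_eq]
    congr 1
    exact hab.integral_eq.symm
  · intro a
    exact (hid 0 a).integral_eq.symm

lemma ae_tendsto_omegaHat (hindep : iIndepFun S P)
    (hident : ∀ i, IdentDistrib (S i) (fun ω => (X ω, W ω, Y ω)) P P₀)
    (hL2 : ∀ a : Coord K, MemLp (fun ω => statVec (X ω, W ω, Y ω) a) 2 P₀) :
    ∀ᵐ ω ∂P, Tendsto (fun n : ℕ => omegaHat (fun i : Fin n => S i ω)) atTop
      (𝓝 (matOmega P₀ X W Y)) := by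
  have h1 := ae_all_iff.2 fun a => ae_tendsto_sampleMean hindep hident
    (measurable_statVec_apply a) ((hL2 a).integrable one_le_two)
  have h2 := ae_all_iff.2 fun a => ae_all_iff.2 fun b => ae_tendsto_sampleMean hindep hident
    ((measurable_statVec_apply a).mul (measurable_statVec_apply b))
    ((hL2 a).integrable_mul (hL2 b))
  filter_upwards [h1, h2] with ω hω1 hω2
  refine tendsto_pi_nhds.2 fun a => tendsto_pi_nhds.2 fun b => ?_
  simp only [omegaHat, matOmega, Matrix.of_apply]
  rw [covariance_eq_sub (hL2 a) (hL2 b)]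
  exact (hω2 a b).sub ((hω1 a).mul (hω1 b))

lemma tendsto_dHat {g : Vec K} (hw : ∀ l, wStar P₀ X W Y (Sum.inr l) ≠ 0)
    (hΛ : ∀ v, popLambda P₀ X W Y v = Psi v (wStar P₀ X W Y))
    (hV : IsUnit (matV P₀ X W Y g)) {s : ∀ n, Fin n → Obs K} {v : ℕ → Vec K}
    (hs : Tendsto (fun n => wHat (s n)) atTop (𝓝 (wStar P₀ X W Y)))
    (hv : Tendsto v atTop (𝓝 g)) :
    Tendsto (fun n => dHat (s n) (v n)) atTop (𝓝 (matD P₀ X W Y g)) := by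
  have hC := contDiffAt_Psi hw g
  have hp : Tendsto (fun n => (wHat (s n), v n)) atTop (𝓝 (wStar P₀ X W Y, g)) :=
    hs.prodMk_nhds hv
  have hVeq : matV P₀ X W Y g = jacobian (fun v => Psi v (wStar P₀ X W Y)) g := by
    rw [matV, funext hΛ]
  rw [matD, hVeq]
  rw [hVeq] at hV
  have hmul : Continuous fun p : Matrix (Fin K) (Fin K) ℝ × Matrix (Fin K) (Coord K) ℝ =>
      p.1 * p.2 := continuous_fst.matrix_mul continuous_snd
  exact ((hmul.tendsto _).comp (((continuousAt_matrix_inv hV).tendsto.comp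
    ((continuousAt_jacobian_snd hC).tendsto.comp hp)).prodMk_nhds
      ((continuousAt_jacobian_fst hC).tendsto.comp hp))).neg

end Sample

end PolyIV

/-! ### Asymptotics of the two-stage estimator -/

theorem theorem4 {K : ℕ} (hK : 2 ≤ K)
    -- the population `(X, W, Y)`
    {Ω₀ : Type*} [MeasurableSpace Ω₀] (P₀ : Measure Ω₀) [IsProbabilityMeasure P₀]
    (X : Ω₀ → Fin K) (W : Ω₀ → Fin 2) (Y : Ω₀ → ℝ)
    (hX : Measurable X) (hW : Measurable W) (hY : Measurable Y)
    -- the iid sample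
    {Ω : Type*} [MeasurableSpace Ω] (P : Measure Ω) [IsProbabilityMeasure P]
    (S : ℕ → Ω → PolyIV.Obs K)
    (hindep : iIndepFun S P)
    (hident : ∀ i, IdentDistrib (S i) (fun ω => (X ω, W ω, Y ω)) P P₀)
    -- conditional moments of order `K + 1`, and both values of the instrument occur
    (hmom : ∀ (l : Fin 2) (k : Fin K),
      Integrable (fun ω => |Y ω| ^ (K + 1)) (P₀[|W ⁻¹' {l} ∩ X ⁻¹' {k}]))
    (hWpos : ∀ l : Fin 2, 0 < P₀ (W ⁻¹' {l}))
    -- identification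
    (g : PolyIV.Vec K) (R : ℝ)
    (hid : ∀ h : PolyIV.Vec K, PolyIV.popGamma P₀ X W Y h = 0 ↔ h = g) (hR : ‖g‖ < R)
    -- invertibility of the Jacobian
    (hV : IsUnit (PolyIV.matV P₀ X W Y g))
    -- the two-stage estimator: a measurable choice of the argmin, constrained only on samples
    -- in which both values of the instrument occur
    (gt : ℕ → Ω → PolyIV.Vec K) (hgt_meas : ∀ n, AEMeasurable (gt n) P)
    (hgt : ∀ n ω, (∀ l : Fin 2, ∃ i : Fin n, (S i ω).2.1 = l) →
      PolyIV.IsTwoStage R (fun i : Fin n => S i ω) (gt n ω)) :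
    -- `- V⁻¹ Δ` is the derivative at `w*` of the implicit function solving `Ψ(ω(w), w) = 0`
    (∃ (A : Set (PolyIV.Vec K)) (B : Set (PolyIV.CoefVec K))
        (om : PolyIV.CoefVec K → PolyIV.Vec K),
      IsOpen A ∧ IsOpen B ∧ g ∈ A ∧ PolyIV.wStar P₀ X W Y ∈ B ∧ Set.MapsTo om B A ∧
      ContDiffOn ℝ 1 om B ∧ om (PolyIV.wStar P₀ X W Y) = g ∧
      (∀ w ∈ B, ∀ v ∈ A, PolyIV.Psi v w = 0 ↔ v = om w) ∧
      PolyIV.jacobian om (PolyIV.wStar P₀ X W Y) = PolyIV.matD P₀ X W Y g) ∧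
    -- asymptotic normality, whenever the covariance matrix `Ω` exists
    ((∀ a : PolyIV.Coord K, MemLp (fun ω => PolyIV.statVec (X ω, W ω, Y ω) a) 2 P₀) →
      TendstoInDistribution (fun (n : ℕ) ω => √(n : ℝ) • (gt n ω - g)) atTop id (fun _ => P)
        (multivariateGaussian (0 : PolyIV.Vec K)
          (PolyIV.matD P₀ X W Y g * PolyIV.matOmega P₀ X W Y * (PolyIV.matD P₀ X W Y g).transpose))) ∧
    -- consistency of the plug-in estimators
    ((∀ (l : Fin 2) (k : Fin K),
        Integrable (fun ω => PolyIV.cellPow (2 * K - 2) l k (X ω, W ω, Y ω)) P₀) →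
      (∀ᵐ ω ∂P, Tendsto (fun n : ℕ => PolyIV.dHat (fun i : Fin n => S i ω) (gt n ω)) atTop
        (𝓝 (PolyIV.matD P₀ X W Y g))) ∧
      (∀ᵐ ω ∂P, Tendsto (fun n : ℕ => PolyIV.omegaHat (fun i : Fin n => S i ω)) atTop
        (𝓝 (PolyIV.matOmega P₀ X W Y)))) := by
  have hint : ∀ j ≤ K + 1, ∀ (l : Fin 2) (k : Fin K),
      Integrable (fun ω => PolyIV.cellPow j l k (X ω, W ω, Y ω)) P₀ := fun j hj l k =>
    PolyIV.integrable_cellPow_of_le hX hW hY hj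
      (PolyIV.integrable_cellPow_of_cond hX hW hY (hmom l k))
  have hΛ := PolyIV.popLambda_eq_Psi hK hW hint
  have hwpos : ∀ l, PolyIV.wStar P₀ X W Y (Sum.inr l) ≠ 0 := fun l =>
    (PolyIV.wStar_inr_pos hW hWpos l).ne'
  have hVeq : PolyIV.matV P₀ X W Y g
      = PolyIV.jacobian (fun v => PolyIV.Psi v (PolyIV.wStar P₀ X W Y)) g := by
    rw [PolyIV.matV, funext hΛ]
  -- the coordinates of `Λ` are the first `K` coordinates of `Γ`
  have h0 : PolyIV.Psi g (PolyIV.wStar P₀ X W Y) = 0 := by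
    rw [← hΛ g]
    have hΓ := (hid g).2 rfl
    ext m
    exact congrArg (fun v : EuclideanSpace ℝ (Fin (K + 2)) => v ⟨m, by omega⟩) hΓ
  obtain ⟨A, B, om, hA, hB, hgA, hwB, hmaps, hcd, hom, hiff, hjac⟩ :=
    PolyIV.exists_implicitFunction_jacobian (PolyIV.contDiffAt_Psi hwpos g) h0 (hVeq ▸ hV)
  have hD : PolyIV.jacobian om (PolyIV.wStar P₀ X W Y) = PolyIV.matD P₀ X W Y g := by
    rw [hjac, PolyIV.matD, hVeq, PolyIV.matDelta]
  have hcdw : ContDiffAt ℝ 1 om (PolyIV.wStar P₀ X W Y) := hcd.contDiffAt (hB.mem_nhds hwB)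
  have hmain := PolyIV.ae_twoStage_eq_implicit hK hX hW hY hindep hident hint hWpos hid hR hgt
    hA hB hgA hwB hmaps hcdw.continuousAt hom hiff
  have hwHat := PolyIV.ae_tendsto_wHat hX hW hY hindep hident hint
  refine ⟨⟨A, B, om, hA, hB, hgA, hwB, hmaps, hcd, hom, hiff, hD⟩, fun hL2 => ?_,
    fun hmom2 => ⟨?_, ?_⟩⟩
  · have hclt := PolyIV.tendstoInDistribution_sqrt_smul_wHat_sub hindep hident hL2
    have hdelta := hclt.delta_method (hcdw.differentiableAt (by simp)).hasFDerivAt hwHat hgt_meas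
      (hmain.mono fun ω hω => hω.2)
    rw [hom] at hdelta
    have hmap := map_multivariateGaussian_zero (S := PolyIV.matOmega P₀ X W Y)
      (posSemidef_covMatrix_of_memLp hL2) (fderiv ℝ om (PolyIV.wStar P₀ X W Y))
    rw [← PolyIV.jacobian_eq_stdMatrix, hD] at hmap
    -- convergence in distribution only depends on the law of the limit
    refine ⟨hdelta.forall_aemeasurable, aemeasurable_id, ?_⟩
    convert! hdelta.tendsto using 3
    exact congrArg 𝓝 (Subtype.ext (Measure.map_id.trans hmap.symm))
  · filter_upwards [hmain, hwHat] with ω hω hw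
    exact PolyIV.tendsto_dHat hwpos hΛ hV hw hω.1
  · exact PolyIV.ae_tendsto_omegaHat hindep hident (PolyIV.memLp_statVec hX hW hY hmom2)
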